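/- Let $G$ be a finite simple undirected graph with an odd number $n$ of vertices, let every vertex $i$ have a stubbornness level $\alpha_i\in(0,1)$, put $a_i=\lfloor \alpha_i/(1-\alpha_i)\rfloor$, and call $i$ stubborn if $a_i\ge\min\{d(i),\,n-d(i)-1\}$, where $d(i)$ is the degree of $i$. For a belief assignment $b\in\{0,1\}^{V(G)}$ and a state (opinion vector) $s\in\{0,1\}^{V(G)}$, the cost of player $i$ is $$c_i(s)=\alpha_i\,|s(i)-b(i)|+(1-\alpha_i)\sum_{j\in N(i)}|s(i)-s(j)| .$$ Let $(s_{-i},a)$ denote $s$ with the $i$-th entry replaced by $a$. A best response move is the change from $s$ to $(s_{-i},1-s(i))$ by one player $i$ with $c_i(s_{-i},1-s(i))<c_i(s)$; an equilibrium is a state from which there is no such move. The assignment $b$ is subvertable if more than half of the vertices have belief $0$ and some finite sequence of best response moves leads from the truthful state $s=b$ to an equilibrium in which more than half of the vertices have opinion $1$. A vertex $u$ is a swing vertex for a subvertable $b$ in which exactly $\frac{n+1}{2}$ vertices have belief $0$ if $b(u)=0$; $c_u(b')<c_u(b)$ for $b'=(b_{-u},1)$; and $c_x(b')\le c_x(b'_{-x},0)$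 for every $x$ with $b(x)=1$. **Theorem.** If at least one vertex of $G$ is non-stubborn, then there are a subvertable belief assignment $b$ with exactly $\frac{n+1}{2}$ vertices of belief $0$ and a swing vertex $u$ for $b$. Moreover, $b$ and $u$ can be computed in polynomial time: there are a single algorithm and a polynomial $T$ such that, for every such instance with vertices $0,\dots,n-1$ and rational levels $\alpha_i=p_i/q_i$ ($p_i,q_i$ integers, $0<p_i<q_i$), the algorithm, given $n$, the adjacency matrix of $G$ and the numbers $p_i,q_i$, halts after at most $T(n)$ steps and outputs such a pair $(b,u)$. The machine model is a random access machine on natural numbers in which each elementary operation (constants, memory access, addition, truncated subtraction, assignment, test for zero) takes one step and there is no multiplication; it is polynomially equivalent to Turing machines. -/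

import Mathlib

/-! ### Binary discrete preference games

`G` is the social network, `α` the stubbornness levels. Beliefs and opinions are Boolean:
`false` stands for `0` and `true` for `1`. -/

namespace PrefGame

open Finset

section Game

variable {V : Type*} [Fintype V]

open Classical in
/-- `c_i(s) = α_i |s(i) - b(i)| + (1 - α_i) ∑_{j ∈ N(i)} |s(i) - s(j)|`. -/
noncomputable def cost (G : SimpleGraph V) (α : V → ℝ) (b s : V → Bool) (i : V) : ℝ :=
  α i * |((s i).toNat : ℝ) - ((b i).toNat : ℝ)| +
    (1 - α i) * ∑ j ∈ G.neighborFinset i, |((s i).toNat : ℝ) - ((s j).toNat : ℝ)|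

open Classical in
/-- The state `(s_{-i}, a)`. -/
noncomputable def play (s : V → Bool) (i : V) (a : Bool) : V → Bool :=
  Function.update s i a

/-- No player can lower her cost by switching to the other opinion. -/
def IsEquilibrium (G : SimpleGraph V) (α : V → ℝ) (b s : V → Bool) : Prop :=
  ∀ i, cost G α b s i ≤ cost G α b (play s i (!(s i))) i

/-- `s'` is obtained from `s` by one best response move: a single player switches to the opinion
that is her best response, that is, she strictly lowers her cost. -/
def BestResponseMove (G : SimpleGraph V) (α : V → ℝ) (b s s' : V → Bool) : Prop :=
  ∃ i, s' = play s i (!(s i)) ∧ cost G α b s' i < cost G α b s i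

/-- More than half of the vertices have value `a` in `s`. -/
def HasMajority (s : V → Bool) (a : Bool) : Prop :=
  Fintype.card V < 2 * #{i | s i = a}

/-- The belief majority is `0`, and some finite sequence of best response moves leads from the
truthful state `b` to an equilibrium with majority `1`. -/
def IsSubvertable (G : SimpleGraph V) (α : V → ℝ) (b : V → Bool) : Prop :=
  HasMajority b false ∧
    ∃ s, Relation.ReflTransGen (BestResponseMove G α b) b s ∧
      IsEquilibrium G α b s ∧ HasMajority s true

/-- `u` is a swing vertex for the subvertable belief assignment `b`, in which exactly
`(n + 1) / 2` vertices have belief `0`. -/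
structure IsSwing (G : SimpleGraph V) (α : V → ℝ) (b : V → Bool) (u : V) : Prop where
  subvertable : IsSubvertable G α b
  card_zero : 2 * #{i | b i = false} = Fintype.card V + 1
  belief_zero : b u = false
  improves : cost G α b (play b u true) u < cost G α b b u
  stays : ∀ x, b x = true →
    cost G α b (play b u true) x ≤ cost G α b (play (play b u true) x false) x

open Classical in
/-- `x` is stubborn: `⌊α_x / (1 - α_x)⌋ ≥ min (d(x)) (n - d(x) - 1)`. -/
def IsStubborn (G : SimpleGraph V) (α : V → ℝ) (x : V) : Prop :=
  min (G.degree x) (Fintype.card V - G.degree x - 1) ≤ ⌊α x / (1 - α x)⌋₊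

end Game

/-! ### Random access machines with unit-cost addition and subtraction

Programs are while-programs over natural-number variables and arrays of natural numbers. Each
elementary operation (constant, variable access, array access at a computed index, addition,
truncated subtraction, assignment, test) takes one step. There is no multiplication, so that the
number of bits of the largest value grows by at most one per step, and running times are polynomially
related to those of Turing machines. -/

/-- Memory contents: `var x` is the value of variable `x`, `arr a k` the `k`-th cell of array
`a`. -/
structure Memory where
  var : ℕ → ℕ
  arr : ℕ → ℕ → ℕ

inductive Expr where
  | lit (k : ℕ)
  | var (x : ℕ)
  | get (a : ℕ) (e : Expr)
  | add (e₁ e₂ : Expr)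
  | sub (e₁ e₂ : Expr)

namespace Expr

def eval (m : Memory) : Expr → ℕ
  | lit k => k
  | var x => m.var x
  | get a e => m.arr a (e.eval m)
  | add e₁ e₂ => e₁.eval m + e₂.eval m
  | sub e₁ e₂ => e₁.eval m - e₂.eval m

/-- The number of elementary operations needed to evaluate an expression. -/
def steps : Expr → ℕ
  | lit _ => 1
  | var _ => 1
  | get _ e => e.steps + 1
  | add e₁ e₂ => e₁.steps + e₂.steps + 1
  | sub e₁ e₂ => e₁.steps + e₂.steps + 1

end Expr

/-- `set x e` is `x := e`, `put a k e` is `a[k] := e`, and a test `e` succeeds iff its value is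
nonzero. -/
inductive Program where
  | skip
  | set (x : ℕ) (e : Expr)
  | put (a : ℕ) (k e : Expr)
  | seq (P Q : Program)
  | ite (e : Expr) (P Q : Program)
  | loop (e : Expr) (P : Program)

/-- `Runs P m m' t`: started with memory `m`, the program `P` halts after exactly `t` steps with
memory `m'`. -/
inductive Runs : Program → Memory → Memory → ℕ → Prop
  | skip (m) : Runs .skip m m 1
  | set (x e m) :
      Runs (.set x e) m ⟨Function.update m.var x (e.eval m), m.arr⟩ (e.steps + 1)
  | put (a k e m) :
      Runs (.put a k e) m
        ⟨m.var, Function.update m.arr a (Function.update (m.arr a) (k.eval m) (e.eval m))⟩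
        (k.steps + e.steps + 1)
  | seq {P Q m₁ m₂ m₃ t₁ t₂} :
      Runs P m₁ m₂ t₁ → Runs Q m₂ m₃ t₂ → Runs (.seq P Q) m₁ m₃ (t₁ + t₂)
  | iteTrue {e P Q m m' t} :
      e.eval m ≠ 0 → Runs P m m' t → Runs (.ite e P Q) m m' (e.steps + t + 1)
  | iteFalse {e P Q m m' t} :
      e.eval m = 0 → Runs Q m m' t → Runs (.ite e P Q) m m' (e.steps + t + 1)
  | loopTrue {e P m₁ m₂ m₃ t₁ t₂} :
      e.eval m₁ ≠ 0 → Runs P m₁ m₂ t₁ → Runs (.loop e P) m₂ m₃ t₂ →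
        Runs (.loop e P) m₁ m₃ (e.steps + t₁ + t₂ + 1)
  | loopFalse {e P m} :
      e.eval m = 0 → Runs (.loop e P) m m (e.steps + 1)

/-! ### Encoding of instances and of outputs -/

open Classical in
/-- The instance with vertices `0, …, n - 1`, graph `G` and stubbornness levels `p i / q i`:
variable `0` holds `n`, array `0` the adjacency matrix row by row, arrays `1` and `2` the
numerators and the denominators. All other cells are `0`. -/
noncomputable def input {n : ℕ} (G : SimpleGraph (Fin n)) (p q : Fin n → ℕ) : Memory where
  var := fun x => if x = 0 then n else 0
  arr := fun a k =>
    if a = 0 then (if ∃ i j : Fin n, k = i.val * n + j.val ∧ G.Adj i j then 1 else 0)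
    else if a = 1 then (if h : k < n then p ⟨k, h⟩ else 0)
    else if a = 2 then (if h : k < n then q ⟨k, h⟩ else 0)
    else 0

/-- The output convention: array `3` holds the belief assignment and variable `1` the vertex. -/
def IsOutput {n : ℕ} (m : Memory) (b : Fin n → Bool) (u : Fin n) : Prop :=
  (∀ i : Fin n, m.arr 3 i = (b i).toNat) ∧ m.var 1 = u

end PrefGame

/-! Write `n = 2k + 1`. A set `W` of `k + 1` vertices is viewed as a camp whose members share one
opinion, in which they also believe. A member `x` *deserts* `W` if even so she prefers the other
opinion, which means `(1 - α x) * (degOut x - degIn x) > α x`; then `x` and the complement of `W`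
form a new camp `flip W x`, again of size `k + 1`.

If `u` deserts `W` and nobody deserts `flip W u`, then `u` is a swing vertex for the assignment `b`
in which exactly the members of `W` believe in `0` (`isSwing_of_deserts`): the condition on `u`
says that she improves by switching to `1`, the one on `flip W u` that afterwards no believer in
`1` wants to leave. From that state players can only want to move from `0` to `1`, and each such
move makes opinion `1` more attractive, so the dynamics ends in an equilibrium that keeps the
majority for `1` (`exists_equilibrium_ge`).

A non-stubborn vertex `v` deserts a set `W ∋ v` that contains as few of its neighbours as possible
(`deserts_of_not_isStubborn`). If somebody deserts the new camp in turn, replace `W` by that camp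
and repeat. Every desertion lowers the cut between `W` and its complement (`cut_flip_lt`), because
a deserter has more neighbours outside `W` than inside. As the cut is at most `n ^ 2`, the process
ends, after polynomially many desertions.

The program runs this process from every vertex `v`. Whether `x` deserts `W` is decided without
division: for `α x = p / q` the condition is `p < (degOut x - degIn x) * (q - p)`
(`deserts_div_iff`), and the product takes at most `n` additions. Its correctness and its running
time are derived with a Hoare calculus with time bounds, `HaltsIn`. -/

namespace PrefGame

open Finset

/-! ### Deserters of a majority and the cut potential -/

section Combinatorics

variable {V : Type*} [Fintype V]

open Classical in
/-- The number of neighbours of `x` in `W`. -/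
noncomputable def degIn (G : SimpleGraph V) (W : Finset V) (x : V) : ℕ :=
  #{j | G.Adj x j ∧ j ∈ W}

open Classical in
/-- The number of neighbours of `x` outside `W`. -/
noncomputable def degOut (G : SimpleGraph V) (W : Finset V) (x : V) : ℕ :=
  #{j | G.Adj x j ∧ j ∉ W}

/-- `x` is a member of `W` that, if its belief is the opinion held by the members of `W`, strictly
prefers the opinion held outside `W`. -/
def Deserts (G : SimpleGraph V) (α : V → ℝ) (W : Finset V) (x : V) : Prop :=
  x ∈ W ∧ α x + (1 - α x) * degIn G W x < (1 - α x) * degOut G W x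

open Classical in
/-- The complement of `W` together with `x`: the camp that `x ∈ W` joins by deserting `W`. -/
noncomputable def flip (W : Finset V) (x : V) : Finset V := {j | j ∉ W ∨ j = x}

/-- The number of edges between `W` and its complement. -/
noncomputable def cut (G : SimpleGraph V) (W : Finset V) : ℕ := ∑ x ∈ W, degOut G W x

@[simp] lemma mem_flip {W : Finset V} {x j : V} : j ∈ flip W x ↔ j ∉ W ∨ j = x := by
  simp [flip]

lemma degIn_add_degOut (G : SimpleGraph V) [DecidableRel G.Adj] (W : Finset V) (x : V) :
    degIn G W x + degOut G W x = G.degree x := by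
  classical
  rw [← G.card_neighborFinset_eq_degree, ← card_filter_add_card_filter_not (fun j => j ∈ W)]
  simp only [degIn, degOut, G.neighborFinset_eq_filter, filter_filter]
  congr!

lemma degOut_le (G : SimpleGraph V) (W : Finset V) (x : V) : degOut G W x ≤ Fintype.card V :=
  card_le_univ _

lemma cut_le (G : SimpleGraph V) (W : Finset V) :
    cut G W ≤ Fintype.card V * Fintype.card V :=
  (sum_le_card_nsmul _ _ _ fun x _ => degOut_le G W x).trans
    (by simpa using Nat.mul_le_mul_right _ (card_le_univ W))

lemma two_mul_card_flip {W : Finset V} {x : V} (hx : x ∈ W)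
    (hW : 2 * #W = Fintype.card V + 1) : 2 * #(flip W x) = Fintype.card V + 1 := by
  classical
  have h : flip W x = insert x Wᶜ := by ext; simp [or_comm]
  rw [h, card_insert_of_notMem (by simpa using hx), card_compl]
  have := card_le_univ W
  omega

open Classical in
lemma cut_eq_sum (G : SimpleGraph V) (W : Finset V) :
    cut G W = ∑ x, ∑ j, if G.Adj x j ∧ x ∈ W ∧ j ∉ W then 1 else 0 := by
  rw [cut, ← sum_filter_add_sum_filter_not univ (fun x => x ∈ W)]
  rw [sum_eq_zero (s := {x | x ∉ W}) (by simp +contextual), add_zero]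
  simp only [filter_univ_mem]
  refine sum_congr rfl fun x hx => ?_
  simp [degOut, hx]

/-- A vertex that leaves `W` trades its cut edges for its uncut edges. -/
lemma cut_flip (G : SimpleGraph V) {W : Finset V} {x : V} (hx : x ∈ W) :
    cut G (flip W x) + degOut G W x = cut G W + degIn G W x := by
  classical
  have e1 : cut G (flip W x) =
      ∑ y, ∑ j, if G.Adj y j ∧ (y ∈ W ∧ y ≠ x) ∧ (j ∉ W ∨ j = x) then 1 else 0 := by
    rw [cut_eq_sum, sum_comm]
    refine sum_congr rfl fun y _ => sum_congr rfl fun j _ => ?_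
    simp only [mem_flip, G.adj_comm j y]
    congr 1
    simp only [not_or, not_not, eq_iff_iff]
    tauto
  have e2 : degOut G W x =
      ∑ y, ∑ j, if G.Adj y j ∧ y = x ∧ j ∉ W then 1 else 0 := by
    rw [sum_eq_single x (by simp +contextual) (by simp)]
    simp [degOut]
  have e3 : degIn G W x =
      ∑ y, ∑ j, if G.Adj y j ∧ y ∈ W ∧ j = x then 1 else 0 := by
    rw [sum_comm, sum_eq_single x (by simp +contextual) (by simp)]
    simp [degIn, G.adj_comm x]
  rw [e1, e2, e3, cut_eq_sum, ← sum_add_distrib, ← sum_add_distrib]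
  refine sum_congr rfl fun y _ => ?_
  rw [← sum_add_distrib, ← sum_add_distrib]
  refine sum_congr rfl fun j _ => ?_
  by_cases h : G.Adj y j
  · have := h.ne
    by_cases h1 : y = x
    · subst h1
      by_cases h2 : j ∈ W <;> simp [h, h2, hx, this.symm]
    · by_cases h2 : j = x
      · subst h2; simp [h1, hx]
      · simp [h1, h2]
  · simp [h]

lemma Deserts.degIn_lt {G : SimpleGraph V} {α : V → ℝ} {W : Finset V} {x : V}
    (hα : α x ∈ Set.Ioo (0 : ℝ) 1) (h : Deserts G α W x) : degIn G W x < degOut G W x := by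
  have h1 : 0 < 1 - α x := by linarith [hα.2]
  have h2 : (1 - α x) * degIn G W x < (1 - α x) * degOut G W x := by linarith [hα.1, h.2]
  exact_mod_cast lt_of_mul_lt_mul_left h2 h1.le

lemma cut_flip_lt {G : SimpleGraph V} {α : V → ℝ} {W : Finset V} {x : V}
    (hα : α x ∈ Set.Ioo (0 : ℝ) 1) (h : Deserts G α W x) : cut G (flip W x) < cut G W := by
  have := h.degIn_lt hα
  have := cut_flip G h.1
  omega

/-- A non-stubborn vertex deserts a majority that meets its neighbourhood as little as the size
`(n + 1) / 2` permits. -/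
lemma deserts_of_not_isStubborn {G : SimpleGraph V} {α : V → ℝ} {W : Finset V} {v : V}
    (hα : α v ∈ Set.Ioo (0 : ℝ) 1) (hv : ¬ IsStubborn G α v) (hW : 2 * #W = Fintype.card V + 1)
    (hvW : v ∈ W) (h : (∀ j ∈ W, ¬ G.Adj v j) ∨ ∀ j, ¬ G.Adj v j → j ∈ W) :
    Deserts G α W v := by
  classical
  refine ⟨hvW, ?_⟩
  have h1 : 0 < 1 - α v := by linarith [hα.2]
  -- The difference `degOut - degIn` equals `d(v)` in the first case, `n - d(v) - 1` in the second.
  have key : ⌊α v / (1 - α v)⌋₊ + 1 + degIn G W v ≤ degOut G W v := by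
    have hs := degIn_add_degOut G W v
    rw [IsStubborn, not_le] at hv
    have hv1 : ⌊α v / (1 - α v)⌋₊ < G.degree v := by convert (lt_min_iff.1 hv).1
    have hv2 : ⌊α v / (1 - α v)⌋₊ < Fintype.card V - G.degree v - 1 := by
      convert (lt_min_iff.1 hv).2
    rcases h with h | h
    · have : degIn G W v = 0 := by
        simp only [degIn, card_eq_zero, filter_eq_empty_iff]
        exact fun j _ hj => h j hj.2 hj.1
      omega
    · have : degOut G W v = #Wᶜ := by
        simp only [degOut]
        congr 1
        ext j
        simp only [mem_filter, mem_univ, true_and, mem_compl, and_iff_right_iff_imp]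
        exact fun hj => by_contra fun hj' => hj (h j hj')
      rw [card_compl] at this
      have := card_le_univ W
      omega
  have h2 : α v / (1 - α v) < (degOut G W v : ℝ) - degIn G W v := by
    have := Nat.lt_floor_add_one (α v / (1 - α v))
    have k : ((⌊α v / (1 - α v)⌋₊ : ℝ) + 1 + degIn G W v) ≤ degOut G W v := by exact_mod_cast key
    linarith
  rw [div_lt_iff₀ h1] at h2
  linarith

lemma exists_deserts {G : SimpleGraph V} {α : V → ℝ} {v : V} (hn : Odd (Fintype.card V))
    (hα : α v ∈ Set.Ioo (0 : ℝ) 1) (hv : ¬ IsStubborn G α v) :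
    ∃ W : Finset V, 2 * #W = Fintype.card V + 1 ∧ Deserts G α W v := by
  classical
  obtain ⟨k, hk⟩ := hn
  let N : Finset V := {j | ¬ G.Adj v j}
  have hvN : v ∈ N := by simp [N]
  -- Either `k + 1` vertices can be chosen among the non-neighbours of `v`, or all of these fit in.
  obtain h | h := le_total (k + 1) #N
  · obtain ⟨W, h1, h2, h3⟩ := exists_subsuperset_card_eq (singleton_subset_iff.2 hvN)
      (by simp) h
    have hW : 2 * #W = Fintype.card V + 1 := by omega
    refine ⟨W, hW, deserts_of_not_isStubborn hα hv hW (by simpa using h1) (.inl fun j hj => ?_)⟩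
    simpa [N] using h2 hj
  · obtain ⟨W, h1, h2, h3⟩ := exists_subsuperset_card_eq (subset_univ N) h
      (by rw [card_univ]; omega)
    have hW : 2 * #W = Fintype.card V + 1 := by omega
    exact ⟨W, hW, deserts_of_not_isStubborn hα hv hW (h1 hvN)
      (.inr fun j hj => h1 (by simpa [N] using hj))⟩

/-! ### Costs and best response dynamics -/

open Classical in
lemma cost_eq (G : SimpleGraph V) (α : V → ℝ) (b s : V → Bool) (i : V) :
    cost G α b s i = (if s i = b i then 0 else α i) +
      (1 - α i) * #{j | G.Adj i j ∧ s j ≠ s i} := by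
  have h (x y : Bool) : |(x.toNat : ℝ) - (y.toNat : ℝ)| = if x = y then 0 else 1 := by
    cases x <;> cases y <;> simp
  simp only [cost, h]
  congr 1
  · split_ifs <;> simp
  · congr 1
    rw [G.neighborFinset_eq_filter, sum_filter, card_filter, Nat.cast_sum]
    refine sum_congr rfl fun j _ => ?_
    by_cases h1 : G.Adj i j <;> by_cases h2 : s i = s j <;> simp [h1, h2, eq_comm]

/-- The cost of a player who follows her belief, where `W` contains the like-minded among her
neighbours and no others of them. -/
lemma cost_of_eq {G : SimpleGraph V} {α : V → ℝ} {b s : V → Bool} {i : V} {W : Finset V}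
    (hi : s i = b i) (h : ∀ j, G.Adj i j → (s j ≠ s i ↔ j ∉ W)) :
    cost G α b s i = (1 - α i) * degOut G W i := by
  classical
  rw [cost_eq, if_pos hi, zero_add, degOut]
  congr 2
  exact congrArg card (filter_congr fun j _ => and_congr_right (h j))

/-- The cost of a player who deviates from her belief, where `W` contains those of her neighbours
who disagree with her and no others of them. -/
lemma cost_of_ne {G : SimpleGraph V} {α : V → ℝ} {b s : V → Bool} {i : V} {W : Finset V}
    (hi : s i ≠ b i) (h : ∀ j, G.Adj i j → (s j ≠ s i ↔ j ∈ W)) :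
    cost G α b s i = α i + (1 - α i) * degIn G W i := by
  classical
  rw [cost_eq, if_neg hi, degIn]
  congr 3
  exact congrArg card (filter_congr fun j _ => and_congr_right (h j))

/-- The more players share a player's opinion, the less it costs her. -/
lemma cost_le_cost {G : SimpleGraph V} {α : V → ℝ} {b s s' : V → Bool} {i : V}
    (hα : α i ≤ 1) (hi : s' i = s i) (h : ∀ j, s j = s i → s' j = s i) :
    cost G α b s' i ≤ cost G α b s i := by
  classical
  rw [cost_eq, cost_eq, hi]
  gcongr ?_ + ?_ * (Nat.cast #?_)
  · linarith [hα]
  · exact fun j hj => by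
      simp only [mem_filter, mem_univ, true_and] at hj ⊢
      exact ⟨hj.1, mt (h j) hj.2⟩

/-- If every player with opinion `1` is content with it, then a sequence of moves from `0` to `1`
ends in an equilibrium: a player with opinion `1` remains content as the others join her. -/
lemma exists_equilibrium_ge {G : SimpleGraph V} {α : V → ℝ} {b : V → Bool}
    (hα : ∀ x, α x ≤ 1) (s : V → Bool)
    (hs : ∀ i, s i = true → cost G α b s i ≤ cost G α b (play s i false) i) :
    ∃ s', Relation.ReflTransGen (BestResponseMove G α b) s s' ∧ IsEquilibrium G α b s' ∧
      ∀ i, s i = true → s' i = true := by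
  classical
  induction hk : #{i | s i = false} using Nat.strong_induction_on generalizing s with
  | _ k ih =>
    by_cases he : IsEquilibrium G α b s
    · exact ⟨s, .refl, he, fun _ h => h⟩
    simp only [IsEquilibrium, not_forall, not_le] at he
    obtain ⟨i, hi⟩ := he
    have hsi : s i = false := by
      by_contra h
      rw [Bool.not_eq_false] at h
      rw [h] at hi
      exact absurd (hs i h) (not_le.2 hi)
    have hmono (j) (hj : s j = true) : play s i true j = true := by
      by_cases hji : j = i <;> simp [play, hji, hj]
    have hs' : ∀ j, play s i true j = true →
        cost G α b (play s i true) j ≤ cost G α b (play (play s i true) j false) j := by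
      intro j hj
      by_cases hji : j = i
      · subst hji
        have : play (play s j true) j false = s := by
          simp [play, ← hsi]
        rw [this]
        simpa [hsi] using hi.le
      · have hsj : s j = true := by simpa [play, hji] using hj
        refine (cost_le_cost (hα j) (by rw [hj, hsj]) ?_).trans
          ((hs j hsj).trans (cost_le_cost (hα j) (by simp [play]) ?_))
        · rw [hsj]; exact hmono
        · intro l
          by_cases hlj : l = j
          · subst hlj; simp [play]
          by_cases hli : l = i
          · subst hli; simp [play, hlj]
          · simp [play, hlj, hli]
    obtain ⟨s', h1, h2, h3⟩ := ih _ (by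
      rw [← hk]
      refine card_lt_card ⟨fun j => ?_, fun h => ?_⟩
      · by_cases hji : j = i <;> simp [play, Function.update_apply, hji]
      · have := (mem_filter.1 (h (by simpa using hsi : i ∈ _))).2
        simp [play] at this) (play s i true) hs' rfl
    refine ⟨s', .head ⟨i, by rw [hsi]; rfl, ?_⟩ h1, h2, fun j hj => h3 j (hmono j hj)⟩
    simpa [hsi] using hi

/-- A swing vertex from a deserter `u` of `W` whose new camp `flip W u` has no deserter: the members
of `W` believe in `0`, the others in `1`. -/
lemma isSwing_of_deserts [DecidableEq V] {G : SimpleGraph V} {α : V → ℝ} {W : Finset V} {u : V}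
    (hα : ∀ x, α x ∈ Set.Ioo (0 : ℝ) 1) (hW : 2 * #W = Fintype.card V + 1)
    (hu : Deserts G α W u) (hf : ∀ x, ¬ Deserts G α (flip W u) x) :
    IsSwing G α (fun i => decide (i ∉ W)) u := by
  classical
  set b : V → Bool := fun i => decide (i ∉ W)
  have hbu : b u = false := by simpa [b] using hu.1
  have hb' (j) : play b u true j = true ↔ j ∈ flip W u := by
    by_cases hj : j = u <;> simp [play, b, hj]
  have hb0 : ({i | b i = false} : Finset V) = W := by ext; simp [b]
  have himp : cost G α b (play b u true) u < cost G α b b u := by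
    rw [cost_of_ne (W := W) (by simp [play, hbu]) fun j hj => ?_,
      cost_of_eq (W := W) rfl fun j _ => by simp [b, hu.1]]
    · exact hu.2
    · simp [play, hj.ne', b]
  have hstay (x) (hx : b x = true) :
      cost G α b (play b u true) x ≤ cost G α b (play (play b u true) x false) x := by
    have hxW : x ∉ W := by simpa [b] using hx
    have hxf : play b u true x = true := by simp [hb', hxW]
    rw [cost_of_eq (W := flip W u) (by rw [hxf, hx]) fun j _ => by rw [hxf, ← hb']]
    rw [cost_of_ne (W := flip W u) (by simp [play, hx]) fun j hj => ?_]
    · exact not_lt.1 fun h => hf x ⟨by simp [hxW], h⟩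
    · rw [← hb']
      simp only [play, Function.update_apply, hj.ne', if_false]
      by_cases hju : j = u <;> simp [hju]
  have hmove : BestResponseMove G α b b (play b u true) :=
    ⟨u, by rw [hbu]; rfl, himp⟩
  obtain ⟨s, h1, h2, h3⟩ := exists_equilibrium_ge (G := G) (b := b) (fun x => (hα x).2.le)
    (play b u true) (by
      intro i hi
      by_cases hiu : i = u
      · subst hiu
        have : play (play b i true) i false = b := by simp [play, ← hbu]
        rw [this]
        exact himp.le
      · exact hstay i (by simpa [play, hiu] using hi))
  have hsub : IsSubvertable G α b := by
    refine ⟨?_, s, .head hmove h1, h2, ?_⟩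
    · rw [HasMajority, hb0]; omega
    · have hc : #(flip W u) ≤ #{i | s i = true} :=
        card_le_card fun j hj => by simpa using h3 j ((hb' j).2 hj)
      have := two_mul_card_flip hu.1 hW
      rw [HasMajority]
      omega
  exact ⟨hsub, by rw [hb0, hW], hbu, himp, hstay⟩

/-- Repeated desertion ends, because it lowers the cut. -/
lemma exists_isSwing [DecidableEq V] {G : SimpleGraph V} {α : V → ℝ} {W : Finset V} {u : V}
    (hα : ∀ x, α x ∈ Set.Ioo (0 : ℝ) 1) (hW : 2 * #W = Fintype.card V + 1)
    (hu : Deserts G α W u) : ∃ b u, IsSwing G α b u := by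
  induction hk : cut G W using Nat.strong_induction_on generalizing W u with
  | _ k ih =>
    by_cases h : ∃ x, Deserts G α (flip W u) x
    · obtain ⟨x, hx⟩ := h
      exact ih _ (hk ▸ cut_flip_lt (hα u) hu) (two_mul_card_flip hu.1 hW) hx rfl
    · exact ⟨_, u, isSwing_of_deserts hα hW hu (not_exists.1 h)⟩

end Combinatorics

/-! ### Total correctness of programs with a time bound -/

namespace Memory

/-- The memory after `x := v`. -/
def setVar (m : Memory) (x v : ℕ) : Memory := ⟨Function.update m.var x v, m.arr⟩

/-- The memory after `a[k] := v`. -/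
def setArr (m : Memory) (a k v : ℕ) : Memory :=
  ⟨m.var, Function.update m.arr a (Function.update (m.arr a) k v)⟩

@[simp] lemma setVar_var (m : Memory) (x v y : ℕ) :
    (m.setVar x v).var y = if y = x then v else m.var y := Function.update_apply ..

@[simp] lemma setVar_arr (m : Memory) (x v : ℕ) : (m.setVar x v).arr = m.arr := rfl

@[simp] lemma setArr_var (m : Memory) (a k v : ℕ) : (m.setArr a k v).var = m.var := rfl

@[simp] lemma setArr_arr (m : Memory) (a k v b : ℕ) : (m.setArr a k v).arr b =
    if b = a then Function.update (m.arr b) k v else m.arr b := by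
  by_cases h : b = a
  · subst h; simp [setArr]
  · simp [setArr, h]

/-- `m` and `m'` differ at most in the variables from `S` and the arrays from `T`. -/
structure EqOff (S T : List ℕ) (m m' : Memory) : Prop where
  var_eq : ∀ y, y ∉ S → m'.var y = m.var y
  arr_eq : ∀ a, a ∉ T → m'.arr a = m.arr a

lemma EqOff.refl (S T : List ℕ) (m : Memory) : EqOff S T m m := ⟨fun _ _ => rfl, fun _ _ => rfl⟩

lemma EqOff.trans {S T S' T' : List ℕ} {m₁ m₂ m₃ : Memory} (h : EqOff S T m₁ m₂)
    (h' : EqOff S' T' m₂ m₃) (hS : S' ⊆ S := by simp) (hT : T' ⊆ T := by simp) :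
    EqOff S T m₁ m₃ :=
  ⟨fun y hy => (h'.1 y fun k => hy (hS k)).trans (h.1 y hy),
    fun y hy => (h'.2 y fun k => hy (hT k)).trans (h.2 y hy)⟩

lemma EqOff.mono {S T S' T' : List ℕ} {m₁ m₂ : Memory} (h : EqOff S T m₁ m₂)
    (hS : S ⊆ S' := by simp) (hT : T ⊆ T' := by simp) : EqOff S' T' m₁ m₂ :=
  ⟨fun y hy => h.1 y fun k => hy (hS k), fun y hy => h.2 y fun k => hy (hT k)⟩

lemma EqOff.setVar {S T : List ℕ} {m₁ m₂ : Memory} (h : EqOff S T m₁ m₂) {x v : ℕ}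
    (hx : x ∈ S := by simp) : EqOff S T m₁ (m₂.setVar x v) := by
  refine ⟨fun y hy => ?_, h.2⟩
  rw [setVar_var, if_neg (show y ≠ x from fun e => hy (e ▸ hx)), h.1 y hy]

lemma EqOff.setArr {S T : List ℕ} {m₁ m₂ : Memory} (h : EqOff S T m₁ m₂) {a k v : ℕ}
    (hx : a ∈ T := by simp) : EqOff S T m₁ (m₂.setArr a k v) := by
  refine ⟨h.1, fun y hy => ?_⟩
  rw [setArr_arr, if_neg (show y ≠ a from fun e => hy (e ▸ hx)), h.2 y hy]

end Memory

open Memory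

/-- Started with memory `m`, the program `P` halts after at most `t` steps with a memory that
satisfies `Q`. -/
def HaltsIn (P : Program) (m : Memory) (t : ℕ) (Q : Memory → Prop) : Prop :=
  ∃ m' s, Runs P m m' s ∧ s ≤ t ∧ Q m'

namespace HaltsIn

variable {P R : Program} {m : Memory} {s t : ℕ} {Q Q' : Memory → Prop} {e k : Expr}

lemma mono (h : HaltsIn P m s Q) (hst : s ≤ t) (hQ : ∀ m', Q m' → Q' m') : HaltsIn P m t Q' := by
  obtain ⟨m', r, h1, h2, h3⟩ := h
  exact ⟨m', r, h1, h2.trans hst, hQ _ h3⟩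

lemma skip (h : Q m) : HaltsIn .skip m 1 Q := ⟨m, 1, .skip m, le_rfl, h⟩

lemma set {x : ℕ} (h : Q (m.setVar x (e.eval m))) : HaltsIn (.set x e) m (e.steps + 1) Q :=
  ⟨_, _, .set x e m, le_rfl, h⟩

lemma put {a : ℕ} (h : Q (m.setArr a (k.eval m) (e.eval m))) :
    HaltsIn (.put a k e) m (k.steps + e.steps + 1) Q :=
  ⟨_, _, .put a k e m, le_rfl, h⟩

lemma seq (h : HaltsIn P m s fun m' => HaltsIn R m' t Q) : HaltsIn (.seq P R) m (s + t) Q := by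
  obtain ⟨m', r, h1, h2, m'', r', h3, h4, h5⟩ := h
  exact ⟨m'', r + r', .seq h1 h3, by omega, h5⟩

lemma bind (h : HaltsIn P m s Q') (h' : ∀ m', Q' m' → HaltsIn R m' t Q) :
    HaltsIn (.seq P R) m (s + t) Q :=
  seq (h.mono le_rfl h')

lemma ite (h1 : e.eval m ≠ 0 → HaltsIn P m t Q) (h2 : e.eval m = 0 → HaltsIn R m t Q) :
    HaltsIn (.ite e P R) m (e.steps + t + 1) Q := by
  by_cases h : e.eval m = 0
  · obtain ⟨m', r, h3, h4, h5⟩ := h2 h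
    exact ⟨m', _, .iteFalse h h3, by omega, h5⟩
  · obtain ⟨m', r, h3, h4, h5⟩ := h1 h
    exact ⟨m', _, .iteTrue h h3, by omega, h5⟩

/-- The loop rule: `I l` is an invariant in which the variant `l` bounds the number of remaining
rounds. -/
lemma loop (I : ℕ → Memory → Prop)
    (h : ∀ l m, I l m → e.eval m ≠ 0 → HaltsIn P m t fun m' => ∃ l' < l, I l' m')
    {l : ℕ} (hm : I l m) :
    HaltsIn (.loop e P) m ((l + 1) * (e.steps + t + 1))
      fun m' => e.eval m' = 0 ∧ ∃ l', I l' m' := by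
  induction l using Nat.strong_induction_on generalizing m with
  | _ l ih =>
    by_cases he : e.eval m = 0
    · exact ⟨m, _, .loopFalse he, by nlinarith, he, l, hm⟩
    · obtain ⟨m₁, r₁, h1, h2, l', hl, h3⟩ := h l m hm he
      obtain ⟨m₂, r₂, h4, h5, h6⟩ := ih l' hl h3
      refine ⟨m₂, _, .loopTrue he h1 h4, ?_, h6⟩
      have : (l' + 1) * (e.steps + t + 1) ≤ l * (e.steps + t + 1) := by gcongr; omega
      linarith

end HaltsIn

/-- `for i in 0, …, n - 1 do P`, where `n` is the value of variable `0`. -/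
def forLoop (i : ℕ) (P : Program) : Program :=
  .seq (.set i (.lit 0))
    (.loop (.sub (.var 0) (.var i)) (.seq P (.set i (.add (.var i) (.lit 1)))))

/-- The rule for `forLoop`: `I k` holds before round `k`, and the body preserves the counter. The
bound `t` on the time of one round is raised to cover the test and the increment. -/
lemma HaltsIn.forLoop {i : ℕ} {P : Program} {m : Memory} {n t : ℕ} (I : ℕ → Memory → Prop)
    (hn : ∀ k m, I k m → m.var 0 = n) (h0 : I 0 (m.setVar i 0))
    (h : ∀ k m, I k m → m.var i = k → k < n →
      HaltsIn P m t fun m' => m'.var i = k ∧ I (k + 1) (m'.setVar i (k + 1))) :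
    HaltsIn (forLoop i P) m ((n + 1) * (t + 10)) (I n) := by
  refine (HaltsIn.seq (HaltsIn.set (?_ : HaltsIn _ _ ((n + 1) * (t + 8)) _))).mono ?_
    fun _ => id
  · refine (HaltsIn.loop (t := t + 4)
      (fun l m => ∃ k, k ≤ n ∧ l = n - k ∧ m.var i = k ∧ I k m) ?_ (l := n) ?_).mono ?_ ?_
    · rintro l m ⟨k, hk, rfl, hi, hI⟩ he
      have h1 : k < n := by
        simp only [Expr.eval, hi, hn k m hI] at he; omega
      refine HaltsIn.seq ((h k m hI hi h1).mono le_rfl ?_)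
      rintro m' ⟨hi', hI'⟩
      refine HaltsIn.set (⟨n - (k + 1), by omega, k + 1, by omega, rfl, ?_, ?_⟩)
      · simp [Expr.eval, hi']
      · simpa [Expr.eval, hi'] using hI'
    · exact ⟨0, by omega, by omega, by simp [Expr.eval], h0⟩
    · simp only [Expr.steps]; exact Nat.mul_le_mul_left _ (by omega)
    · rintro m' ⟨he, l, k, hk, rfl, hi, hI⟩
      have h1 : k = n := by
        simp only [Expr.eval, hi, hn k m' hI] at he; omega
      exact h1 ▸ hI
  · simp only [Expr.steps]; nlinarith

/-- `z := e₁ * e₂` by repeated addition, with the counter `c`. -/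
def mulProgram (z c : ℕ) (e₁ e₂ : Expr) : Program :=
  .seq (.set c e₁) (.seq (.set z (.lit 0))
    (.loop (.var c) (.seq (.set z (.add (.var z) e₂)) (.set c (.sub (.var c) (.lit 1))))))

/-- The product is correct if the second factor does not depend on the two variables used. -/
lemma HaltsIn.mulProgram {z c a b t : ℕ} {e₁ e₂ : Expr} {m : Memory} (hzc : z ≠ c)
    (h1 : e₁.eval m = a) (h2 : ∀ m', EqOff [z, c] [] m m' → e₂.eval m' = b) (ha : a ≤ t) :
    HaltsIn (mulProgram z c e₁ e₂) m ((t + 1) * (e₂.steps + 12) + e₁.steps)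
      fun m' => EqOff [z, c] [] m m' ∧ m'.var z = a * b := by
  refine (HaltsIn.seq (HaltsIn.set (HaltsIn.seq (HaltsIn.set
    (?_ : HaltsIn _ _ ((a + 1) * (e₂.steps + 9)) _))))).mono ?_ fun _ => id
  · refine (HaltsIn.loop (t := e₂.steps + 7)
      (fun l m' => l ≤ a ∧ EqOff [z, c] [] m m' ∧ m'.var c = l ∧ m'.var z = (a - l) * b)
        ?_ (l := a) ?_).mono ?_ ?_
    · rintro l m' ⟨hl, hE, hc, hz⟩ he
      simp only [Expr.eval, hc] at he
      refine (HaltsIn.seq (HaltsIn.set (HaltsIn.set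
        ⟨l - 1, by omega, by omega, hE.setVar.setVar, ?_, ?_⟩))).mono ?_ fun _ => id
      · simp only [Expr.steps]; omega
      · simp [Expr.eval, hzc.symm, hc]
      · obtain ⟨d, rfl⟩ : ∃ d, a = l + d := ⟨a - l, by omega⟩
        have e1 : l + d - (l - 1) = d + 1 := by omega
        simp [Expr.eval, hzc, hz, h2 m' hE, e1, add_mul]
    · exact ⟨le_rfl, (EqOff.refl ..).setVar.setVar, by simp [hzc.symm, h1], by simp [Expr.eval]⟩
    · simp only [Expr.steps]; exact Nat.mul_le_mul_left _ (by omega)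
    · rintro m' ⟨he, l, hl, hE, hc, hz⟩
      simp only [Expr.eval, hc] at he
      subst he
      exact ⟨hE, hz⟩
  · simp only [Expr.steps]
    have : (a + 1) * (e₂.steps + 9) ≤ (t + 1) * (e₂.steps + 9) := by gcongr
    nlinarith

/-! ### The program -/

namespace Program

/-! Use of the memory beyond the input and output cells: array `4` holds the indicator function of
the current set `W` and `var 10` the size of `W` while it is built; `var 2` is the vertex from
which the process starts, `var 3` the vertex under examination, `var 4` the counter of inner loops,
`var 8` the counter of multiplications, `var 9` the start of a row of the adjacency matrix; `var
5`, `var 6` and `var 7` serve the test for desertion. -/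

/-- Adds vertices to the set encoded in array `4`, in increasing order, as long as its size `var
10` is less than `(n + 1) / 2`. With `c = 0` only non-neighbours of the vertex whose row of the
adjacency matrix starts at `var 9` are added, with `c = 1` all vertices. -/
def fill (c : ℕ) : Program :=
  forLoop 4 (.ite
    -- With truncated subtraction the value is `1` if `W[j] = 0`, `adj ≤ c` and
    -- `2 * size < n + 1`, and `0` otherwise.
    (.sub (.lit 1) (.add (.get 4 (.var 4))
      (.add (.sub (.get 0 (.add (.var 9) (.var 4))) (.lit c))
        (.sub (.lit 1) (.sub (.add (.var 0) (.lit 1)) (.add (.var 10) (.var 10)))))))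
    (.seq (.put 4 (.var 4) (.lit 1)) (.set 10 (.add (.var 10) (.lit 1)))) .skip)

/-- Stores in array `4` a set of `(n + 1) / 2` vertices that contains the vertex `var 2` and as few
of its neighbours as possible. -/
def camp : Program :=
  .seq (forLoop 4 (.put 4 (.var 4) (.lit 0)))
    (.seq (.put 4 (.var 2) (.lit 1))
      (.seq (.set 10 (.lit 1))
        (.seq (mulProgram 9 8 (.var 2) (.var 0)) (.seq (fill 0) (fill 1)))))

/-- Counts in `var 5` and `var 6` the neighbours of the vertex `var 3` outside and inside the set
encoded in array `4`, and stores in `var 7` their difference times `q - p`. -/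
def inspect : Program :=
  .seq (mulProgram 9 8 (.var 3) (.var 0))
    (.seq (.set 5 (.lit 0)) (.seq (.set 6 (.lit 0))
      (.seq (forLoop 4 (.seq
        (.set 5 (.add (.var 5) (.sub (.get 0 (.add (.var 9) (.var 4))) (.get 4 (.var 4)))))
        (.set 6 (.add (.var 6) (.sub (.get 0 (.add (.var 9) (.var 4)))
          (.sub (.lit 1) (.get 4 (.var 4))))))))
        (mulProgram 7 8 (.sub (.var 5) (.var 6))
          (.sub (.get 2 (.var 3)) (.get 1 (.var 3)))))))

/-- Outputs the complement of the set `W` encoded in array `4` and the vertex `x = var 3`, replaces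
`W` by `flip W x` and sets `var 3` to `0`. -/
def desert : Program :=
  .seq (forLoop 4 (.seq (.put 3 (.var 4) (.sub (.lit 1) (.get 4 (.var 4))))
      (.put 4 (.var 4) (.sub (.lit 1) (.get 4 (.var 4))))))
    (.seq (.put 4 (.var 3) (.lit 1)) (.seq (.set 1 (.var 3)) (.set 3 (.lit 0))))

/-- Lets vertices desert the set encoded in array `4` until it has no deserter. All vertices below
`var 3` are known not to desert the current set, so the search restarts from `0` after each
desertion. -/
def improve : Program :=
  .seq (.set 3 (.lit 0)) (.loop (.sub (.var 0) (.var 3))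
    (.seq inspect
      -- The value is `1` if `W[x] = 1` and `p < (degOut - degIn) * (q - p)`, and `0` otherwise.
      (.ite (.sub (.get 4 (.var 3)) (.sub (.lit 1) (.sub (.var 7) (.get 1 (.var 3)))))
        desert (.set 3 (.add (.var 3) (.lit 1))))))

/-- Starts the desertion process from every vertex. -/
def swing : Program := forLoop 2 (.seq camp improve)

end Program

/-! ### Correctness of the program -/

section Correctness

variable {n : ℕ} {G : SimpleGraph (Fin n)} {p q : Fin n → ℕ} {m m' : Memory}

open Classical in
/-- The memory contains the instance `G`, `p`, `q`. -/
structure Loaded (G : SimpleGraph (Fin n)) (p q : Fin n → ℕ) (m : Memory) : Prop where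
  size : m.var 0 = n
  adj : ∀ i j : Fin n, m.arr 0 (i * n + j) = if G.Adj i j then 1 else 0
  num : ∀ i : Fin n, m.arr 1 i = p i
  den : ∀ i : Fin n, m.arr 2 i = q i

/-- Array `4` holds the indicator function of `W`. -/
def Coded (m : Memory) (W : Finset (Fin n)) : Prop :=
  ∀ i : Fin n, m.arr 4 i = if i ∈ W then 1 else 0

/-- The output cells hold a swing vertex and its belief assignment. -/
def Solved (G : SimpleGraph (Fin n)) (p q : Fin n → ℕ) (m : Memory) : Prop :=
  ∃ b u, IsSwing G (fun i => (p i : ℝ) / (q i : ℝ)) b u ∧ IsOutput m b u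

lemma loaded_input : Loaded G p q (input G p q) := by
  refine ⟨by simp [input], fun i j => ?_, fun i => by simp [input], fun i => by simp [input]⟩
  have : (∃ i' j' : Fin n, i.val * n + j.val = i'.val * n + j'.val ∧ G.Adj i' j') ↔ G.Adj i j := by
    refine ⟨?_, fun h => ⟨i, j, rfl, h⟩⟩
    rintro ⟨i', j', h, h'⟩
    have hn : 0 < n := i.pos
    have h1 : i = i' := by
      have := congrArg (· / n) h
      simpa [Nat.mul_add_div, mul_comm _ n, hn, Nat.div_eq_of_lt, Fin.ext_iff] using this
    subst h1
    have h2 : j = j' := by simpa [Fin.ext_iff] using h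
    exact h2 ▸ h'
  simp only [input, if_true]
  by_cases h : G.Adj i j
  · rw [if_pos (this.2 h), if_pos h]
  · rw [if_neg (mt this.1 h), if_neg h]

lemma Loaded.congr {S T : List ℕ} (h : Loaded G p q m) (hE : EqOff S T m m')
    (hS : 0 ∉ S := by simp) (h0 : 0 ∉ T := by simp) (h1 : 1 ∉ T := by simp)
    (h2 : 2 ∉ T := by simp) : Loaded G p q m' := by
  refine ⟨?_, ?_, ?_, ?_⟩
  · rw [hE.1 _ hS, h.size]
  · rw [hE.2 _ h0]; exact h.adj
  · rw [hE.2 _ h1]; exact h.num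
  · rw [hE.2 _ h2]; exact h.den

lemma Coded.insert {W : Finset (Fin n)} (h : Coded m W) (i : Fin n) :
    Coded (m.setArr 4 i 1) (insert i W) := by
  intro j
  by_cases hj : j = i
  · subst hj; simp
  · have : (j : ℕ) ≠ i := fun e => hj (Fin.ext e)
    simp [hj, this, h j]

open Classical in
/-- `fill c` adds only vertices permitted by `c`, and stops short of `(n + 1) / 2` vertices only if
all permitted ones are in the set. -/
lemma HaltsIn.fill {W : Finset (Fin n)} {c : ℕ} {v : Fin n} (hn : Odd n) (hL : Loaded G p q m)
    (hC : Coded m W) (hv : m.var 9 = v * n) (hcard : m.var 10 = #W) (hW : 2 * #W ≤ n + 1) :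
    HaltsIn (Program.fill c) m ((n + 1) * 39) fun m' => EqOff [4, 10] [4] m m' ∧
      ∃ W' : Finset (Fin n), Coded m' W' ∧ m'.var 10 = #W' ∧ W ⊆ W' ∧ 2 * #W' ≤ n + 1 ∧
        (∀ j ∈ W', j ∉ W → (if G.Adj v j then 1 else 0) ≤ c) ∧
        (2 * #W' = n + 1 ∨ ∀ j, (if G.Adj v j then 1 else 0) ≤ c → j ∈ W') := by
  obtain ⟨d, hd⟩ := hn
  refine (HaltsIn.forLoop (t := 29) (fun k m' => EqOff [4, 10] [4] m m' ∧
      ∃ W' : Finset (Fin n), Coded m' W' ∧ m'.var 10 = #W' ∧ W ⊆ W' ∧ 2 * #W' ≤ n + 1 ∧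
        (∀ j ∈ W', j ∉ W → (if G.Adj v j then 1 else 0) ≤ c) ∧
        (2 * #W' = n + 1 ∨ ∀ j : Fin n, j < k → (if G.Adj v j then 1 else 0) ≤ c → j ∈ W'))
    (fun k m' h => (hL.congr h.1).size) ?_ ?_).mono le_rfl ?_
  · exact ⟨(EqOff.refl ..).setVar, W, hC, hcard, subset_rfl, hW, fun j h h' => (h' h).elim,
      .inr fun j h => absurd h (Nat.not_lt_zero _)⟩
  · rintro k m' ⟨hE, W', h1, h2, h3, h4, h5, h6⟩ hk hkn
    have hb := (hL.congr hE).adj v ⟨k, hkn⟩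
    have hw := h1 ⟨k, hkn⟩
    simp only at hb hw
    have h9 : m'.var 9 = v * n := by rw [hE.1 _ (by simp), hv]
    have h0 := (hL.congr hE).size
    refine HaltsIn.ite (t := 7) (fun he => ?_) (fun he => ?_)
    · simp only [Expr.eval, hk, h9, h0, h2, hb, hw] at he
      have hkW : (⟨k, hkn⟩ : Fin n) ∉ W' := by
        intro h; simp only [h, if_true] at he; omega
      refine HaltsIn.seq (HaltsIn.put (HaltsIn.set ⟨by simpa using hk,
        (hE.setArr.setVar).setVar, insert ⟨k, hkn⟩ W', ?_, ?_, ?_, ?_, ?_, ?_⟩))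
      · have := h1.insert ⟨k, hkn⟩
        simp only [Expr.eval, hk]
        exact this
      · simp [Expr.eval, h2, card_insert_of_notMem hkW]
      · exact h3.trans (subset_insert _ _)
      · rw [card_insert_of_notMem hkW]; omega
      · intro j hj hjW
        rcases mem_insert.1 hj with rfl | hj
        · omega
        · exact h5 j hj hjW
      · refine h6.imp (fun h => by omega) fun h j hj hjc => ?_
        by_cases hjk : j = ⟨k, hkn⟩
        · simp [hjk]
        · exact mem_insert_of_mem (h j (by
            have : (j : ℕ) ≠ k := fun e => hjk (Fin.ext e)
            omega) hjc)
    · simp only [Expr.eval, hk, h9, h0, h2, hb, hw] at he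
      refine HaltsIn.mono (HaltsIn.skip ⟨hk, hE.setVar, W', h1, by simp [h2], h3, h4, h5, ?_⟩)
        (by norm_num) fun _ => id
      rcases h6 with h6 | h6
      · exact .inl h6
      by_cases hc : 2 * #W' = n + 1
      · exact .inl hc
      refine .inr fun j hj hjc => ?_
      by_cases hjk : j = ⟨k, hkn⟩
      · by_contra hjW
        subst hjk
        simp only [hjW, if_false] at he
        omega
      · exact h6 j (by
            have : (j : ℕ) ≠ k := fun e => hjk (Fin.ext e)
            omega) hjc
  · rintro m' ⟨hE, W', h1, h2, h3, h4, h5, h6⟩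
    exact ⟨hE, W', h1, h2, h3, h4, h5, h6.imp_right fun h j => h j j.2⟩

/-- The set built by `camp` meets the condition of `deserts_of_not_isStubborn`. -/
lemma HaltsIn.camp {v : Fin n} (hn : Odd n) (hL : Loaded G p q m) (hv : m.var 2 = v) :
    HaltsIn Program.camp m ((n + 1) * 200) fun m' => EqOff [4, 8, 9, 10] [4] m m' ∧
      ∃ W : Finset (Fin n), Coded m' W ∧ 2 * #W = n + 1 ∧ v ∈ W ∧
        ((∀ j ∈ W, ¬ G.Adj v j) ∨ ∀ j, ¬ G.Adj v j → j ∈ W) := by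
  classical
  refine HaltsIn.mono (HaltsIn.bind (HaltsIn.forLoop (n := n) (t := 3) (fun k m' =>
      EqOff [4, 8, 9, 10] [4] m m' ∧ ∀ j < k, m'.arr 4 j = 0)
      (fun k m' h => (hL.congr h.1).size) ?_ ?_)
    fun m₁ h₁ => HaltsIn.seq (HaltsIn.put (HaltsIn.seq (HaltsIn.set (HaltsIn.bind
      (HaltsIn.mulProgram (a := v) (b := n) (t := n) (by simp) ?_ ?_ v.2.le) fun m₂ h₂ =>
      HaltsIn.bind (t := (n + 1) * 39) (HaltsIn.fill (G := G) (p := p) (q := q) (W := {v}) (v := v)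
        hn ?_ ?_ ?_ ?_ ?_) fun m₃ h₃ => ?_))))) ?_ fun _ => id
  · exact ⟨(EqOff.refl ..).setVar, by simp⟩
  · rintro k m' ⟨hE, h⟩ hk hkn
    refine HaltsIn.put ⟨by simpa using hk, hE.setArr.setVar, fun j hj => ?_⟩
    by_cases hjk : j = k
    · simp [Expr.eval, hk, hjk]
    · simp [Expr.eval, hk, hjk, h j (by omega)]
  · simp [Expr.eval, h₁.1.1, hv]
  · intro m' hE
    exact (hL.congr (h₁.1.setArr.setVar.trans hE)).size
  · exact hL.congr (h₁.1.setArr.setVar.trans h₂.1)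
  · have : Coded m₁ ∅ := fun i => by simpa using h₁.2 i i.2
    have := this.insert v
    intro j
    rw [h₂.1.2 _ (by simp)]
    simpa [Expr.eval, h₁.1.1, hv] using this j
  · exact h₂.2
  · rw [h₂.1.1 _ (by simp)]
    simp [Expr.eval]
  · obtain ⟨d, rfl⟩ := hn
    simp
  · obtain ⟨hE3, W, h1, h2, h3, h4, h5, h6⟩ := h₃
    have hE := (h₁.1.setArr.setVar.trans h₂.1).trans hE3
    have h9 : m₃.var 9 = v * n := by rw [hE3.1 _ (by simp), h₂.2]
    have hvW : v ∈ W := h3 (by simp)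
    refine (HaltsIn.fill (v := v) hn (hL.congr hE) h1 h9 h2 h4).mono le_rfl ?_
    rintro m₄ ⟨hE4, W', g1, g2, g3, g4, g5, g6⟩
    have hcard : 2 * #W' = n + 1 := by
      refine g6.elim id fun g => ?_
      have : W' = univ := eq_univ_of_forall fun j => g j (by split_ifs <;> simp)
      rw [this, card_univ, Fintype.card_fin] at g4 ⊢
      have := hn.pos
      omega
    refine ⟨hE.trans hE4, W', g1, hcard, g3 hvW, ?_⟩
    -- If the non-neighbours suffice to fill the set, then the second call of `fill` adds nothing.
    rcases h6 with h6 | h6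
    · have : W = W' := eq_of_subset_of_card_le g3 (by omega)
      subst this
      refine .inl fun j hj hj' => ?_
      have := h5 j hj (by simpa using hj'.ne')
      simp [hj'] at this
    · exact .inr fun j hj => g3 (h6 j (by simp [hj]))
  · simp only [Expr.steps]; omega

lemma HaltsIn.inspect {x : Fin n} {W : Finset (Fin n)} (hL : Loaded G p q m) (hC : Coded m W)
    (hx : m.var 3 = x) :
    HaltsIn Program.inspect m ((n + 1) * 100) fun m' => EqOff [4, 5, 6, 7, 8, 9] [] m m' ∧
      m'.var 7 = (degOut G W x - degIn G W x) * (q x - p x) := by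
  classical
  let f (l : ℕ) := m.arr 0 (x * n + l)
  have hf (l : Fin n) : f l = if G.Adj x l then 1 else 0 := hL.adj x l
  refine HaltsIn.mono (HaltsIn.bind
      (HaltsIn.mulProgram (a := x) (b := n) (t := n) (by simp) hx ?_ x.2.le)
    fun m₁ h₁ => HaltsIn.seq (HaltsIn.set (HaltsIn.seq (HaltsIn.set (HaltsIn.bind
      (t := (n + 1) * 17 + 3) (HaltsIn.forLoop (n := n) (t := 22)
        (fun k m' => EqOff [4, 5, 6, 7, 8, 9] [] m m' ∧
          m'.var 9 = x * n ∧
          m'.var 5 = ∑ l ∈ range k, (f l - m.arr 4 l) ∧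
          m'.var 6 = ∑ l ∈ range k, (f l - (1 - m.arr 4 l)))
        (fun k m' h => (hL.congr h.1).size) ?_ ?_) fun m₂ h₂ => ?_))))) ?_ fun _ => id
  rotate_left 3
  · obtain ⟨hE, -, h5, h6⟩ := h₂
    have e5 : m₂.var 5 = degOut G W x := by
      rw [h5, sum_range, degOut, card_filter]
      refine sum_congr rfl fun l _ => ?_
      rw [hf, hC]
      by_cases h : G.Adj x l <;> by_cases h' : l ∈ W <;> simp [h, h']
    have e6 : m₂.var 6 = degIn G W x := by
      rw [h6, sum_range, degIn, card_filter]
      refine sum_congr rfl fun l _ => ?_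
      rw [hf, hC]
      by_cases h : G.Adj x l <;> by_cases h' : l ∈ W <;> simp [h, h']
    refine (HaltsIn.mulProgram (t := n) (a := degOut G W x - degIn G W x) (b := q x - p x)
      (by simp) ?_ ?_ ?_).mono le_rfl ?_
    · simp [Expr.eval, e5, e6]
    · intro m' hE'
      have hE2 := hE.trans hE'
      have h3 : m'.var 3 = x := by rw [hE2.1 _ (by simp), hx]
      simp [Expr.eval, h3, (hL.congr hE2).num, (hL.congr hE2).den]
    · have := degOut_le G W x
      rw [Fintype.card_fin] at this
      omega
    · rintro m' ⟨hE', h7⟩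
      exact ⟨hE.trans hE', h7⟩
  · simp only [Expr.steps]; omega
  · exact fun m' hE => (hL.congr hE).size
  · exact ⟨(h₁.1.mono.setVar).setVar.setVar, by simp [h₁.2], by simp [Expr.eval],
      by simp [Expr.eval]⟩
  · rintro k m' ⟨hE, h9, h5, h6⟩ hk hkn
    have e0 : m'.arr 0 (x * n + k) = f k := by rw [hE.2 _ (by simp)]
    have e4 : m'.arr 4 = m.arr 4 := hE.2 _ (by simp)
    refine HaltsIn.mono (HaltsIn.seq (HaltsIn.set (HaltsIn.set
      ⟨by simpa using hk, hE.setVar.setVar.setVar, by simpa using h9, ?_, ?_⟩))) ?_ fun _ => id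
    · simp [Expr.steps]
    · simp [Expr.eval, sum_range_succ, hk, h9, e0, e4, h5]
    · simp [Expr.eval, sum_range_succ, hk, h9, e0, e4, h6]

lemma HaltsIn.desert {x : Fin n} {W : Finset (Fin n)} (hL : Loaded G p q m) (hC : Coded m W)
    (hx : m.var 3 = x) :
    HaltsIn Program.desert m ((n + 1) * 50) fun m' => EqOff [1, 3, 4] [3, 4] m m' ∧
      Coded m' (flip W x) ∧ IsOutput m' (fun i => decide (i ∉ W)) x ∧ m'.var 3 = 0 := by
  refine HaltsIn.mono (HaltsIn.bind (HaltsIn.forLoop (n := n) (t := 12) (fun k m' =>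
      EqOff [4] [3, 4] m m' ∧ (∀ j < k, m'.arr 3 j = 1 - m.arr 4 j) ∧
      ∀ j, m'.arr 4 j = if j < k then 1 - m.arr 4 j else m.arr 4 j)
      (fun k m' h => (hL.congr h.1).size) ?_ ?_)
    fun m₁ h₁ => HaltsIn.seq (HaltsIn.put (HaltsIn.seq (HaltsIn.set (HaltsIn.set ?_)))))
    ?_ fun _ => id
  · exact ⟨(EqOff.refl ..).setVar, by simp, by simp⟩
  · rintro k m' ⟨hE, h3, h4⟩ hk hkn
    refine HaltsIn.mono (HaltsIn.seq (HaltsIn.put (HaltsIn.put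
      ⟨by simpa using hk, hE.setArr.setArr.setVar, ?_, ?_⟩))) ?_ fun _ => id
    · simp [Expr.steps]
    · intro j hj
      by_cases hjk : j = k
      · simp [Expr.eval, hk, hjk, h4]
      · simp [Expr.eval, hk, hjk, h3 j (by omega)]
    · intro j
      by_cases hjk : j = k
      · simp [Expr.eval, hk, hjk, h4]
      · have : j < k + 1 ↔ j < k := by omega
        simp [Expr.eval, hk, hjk, h4, this]
  · obtain ⟨hE, h3, h4⟩ := h₁
    have hx1 : m₁.var 3 = x := by rw [hE.1 _ (by simp), hx]
    refine ⟨(hE.mono (S' := [1, 3, 4]) (T' := [3, 4])).setArr.setVar.setVar, ?_, ⟨?_, ?_⟩, ?_⟩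
    · intro j
      by_cases hj : j = x
      · simp [Expr.eval, hx1, hj]
      · have : (j : ℕ) ≠ x := fun e => hj (Fin.ext e)
        by_cases hjW : j ∈ W <;> simp [Expr.eval, hx1, hj, this, h4, hC j, hjW]
    · intro j
      by_cases hjW : j ∈ W <;> simp [Expr.eval, h3 j j.2, hC j, hjW]
    · simp [Expr.eval, hx1]
    · simp [Expr.eval]
  · simp only [Expr.steps]; omega

/-- Desertion for a rational level `p / q` in terms of natural numbers; where the truncated
difference of the degrees is `0`, both sides fail. -/
lemma deserts_div_iff {W : Finset (Fin n)} {x : Fin n} (hpq : 0 < p x ∧ p x < q x) :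
    Deserts G (fun i => (p i : ℝ) / (q i : ℝ)) W x ↔
      x ∈ W ∧ p x < (degOut G W x - degIn G W x) * (q x - p x) := by
  refine and_congr_right fun _ => ?_
  have hq : (0 : ℝ) < q x := by exact_mod_cast hpq.1.trans hpq.2
  obtain ⟨r, hr⟩ := Nat.exists_eq_add_of_lt hpq.2
  have e1 : (1 - (p x : ℝ) / q x) = ((r + 1 : ℕ) : ℝ) / q x := by
    rw [eq_div_iff hq.ne', sub_mul, div_mul_cancel₀ _ hq.ne', hr]
    push_cast
    ring
  have e2 : q x - p x = r + 1 := by omega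
  rw [e1, e2, div_mul_eq_mul_div, div_mul_eq_mul_div, ← add_div, div_lt_div_iff_of_pos_right hq]
  norm_cast
  rw [tsub_mul, Nat.lt_sub_iff_add_lt, mul_comm (r + 1), mul_comm (r + 1)]

lemma div_mem_Ioo (hpq : ∀ i, 0 < p i ∧ p i < q i) (i : Fin n) :
    (p i : ℝ) / (q i : ℝ) ∈ Set.Ioo (0 : ℝ) 1 := by
  have h1 : (0 : ℝ) < p i := by exact_mod_cast (hpq i).1
  have h2 : (p i : ℝ) < q i := by exact_mod_cast (hpq i).2
  exact ⟨div_pos h1 (h1.trans h2), (div_lt_one (h1.trans h2)).2 h2⟩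

/-- Either no vertex deserts the initial set, and the output cells are unchanged, or the output
cells hold a solution in the end. -/
lemma HaltsIn.improve {W₀ : Finset (Fin n)} (hpq : ∀ i, 0 < p i ∧ p i < q i)
    (hL : Loaded G p q m) (hC : Coded m W₀) (hW₀ : 2 * #W₀ = n + 1) :
    HaltsIn Program.improve m (200 * (n + 1) ^ 4)
      fun m' => EqOff [1, 3, 4, 5, 6, 7, 8, 9] [3, 4] m m' ∧
        (((∀ x, ¬ Deserts G (fun i => (p i : ℝ) / (q i : ℝ)) W₀ x) ∧
            m'.arr 3 = m.arr 3 ∧ m'.var 1 = m.var 1) ∨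
          Solved G p q m') := by
  set α : Fin n → ℝ := fun i => (p i : ℝ) / (q i : ℝ)
  -- The variant is lexicographic: a desertion lowers the cut, a step of the search lowers
  -- `n - var 3`. After the first desertion the current set is the camp that the vertex in the output
  -- cell has just joined; the output is a solution as soon as nobody deserts that camp.
  let I (l : ℕ) (m' : Memory) : Prop := EqOff [1, 3, 4, 5, 6, 7, 8, 9] [3, 4] m m' ∧
    ∃ W : Finset (Fin n), Coded m' W ∧ 2 * #W = n + 1 ∧ m'.var 3 ≤ n ∧
      l = cut G W * (n + 1) + (n - m'.var 3) ∧
      (∀ y : Fin n, y < m'.var 3 → ¬ Deserts G α W y) ∧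
      ((W = W₀ ∧ m'.arr 3 = m.arr 3 ∧ m'.var 1 = m.var 1) ∨
        ∃ V u, Deserts G α V u ∧ 2 * #V = n + 1 ∧ W = flip V u ∧
          IsOutput m' (fun i => decide (i ∉ V)) u)
  refine HaltsIn.mono (HaltsIn.seq (HaltsIn.set ((HaltsIn.loop (t := (n + 1) * 160) I ?_
    (l := cut G W₀ * (n + 1) + n) ?_).mono le_rfl ?_))) ?_ fun _ => id
  · rintro l m₁ ⟨hE, W, h1, h2, h3, rfl, h5, h6⟩ he
    have hL1 := hL.congr hE
    have hlt : m₁.var 3 < n := by simp only [Expr.eval, hL1.size] at he; omega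
    obtain ⟨x, hx⟩ : ∃ x : Fin n, m₁.var 3 = x := ⟨⟨_, hlt⟩, rfl⟩
    refine HaltsIn.mono (HaltsIn.bind (HaltsIn.inspect hL1 h1 hx) fun m₂ ⟨hE2, h7⟩ =>
      HaltsIn.ite (t := (n + 1) * 50) (fun hb => ?_) fun hb => ?_) ?_ fun _ => id
    rotate_left 2
    · simp only [Expr.steps]; omega
    all_goals
      have hL2 := hL1.congr hE2
      have hx2 : m₂.var 3 = x := by rw [hE2.1 _ (by simp), hx]
      have hC2 : Coded m₂ W := fun i => by rw [hE2.2 _ (by simp), h1]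
      simp only [Expr.eval, hx2, h7, hL2.num, hC2 x] at hb
    · have hd : Deserts G α W x := by
        rw [deserts_div_iff (hpq x)]
        by_cases hxW : x ∈ W
        · simp only [hxW, if_true] at hb
          exact ⟨hxW, by omega⟩
        · simp only [hxW, if_false] at hb
          omega
      refine (HaltsIn.desert hL2 hC2 hx2).mono le_rfl ?_
      rintro m₃ ⟨hE3, g1, g2, g3⟩
      refine ⟨_, ?_, (hE.trans hE2).trans hE3, flip W x, g1, ?_, by omega, rfl, ?_,
        .inr ⟨W, x, hd, h2, rfl, g2⟩⟩
      · have := Nat.mul_le_mul_right (n + 1) (Nat.succ_le_of_lt 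
          (cut_flip_lt (α := α) (div_mem_Ioo hpq x) hd))
        rw [g3, Nat.succ_mul] at *
        omega
      · simpa using two_mul_card_flip hd.1 (by simpa using h2)
      · intro y hy
        omega
    · refine HaltsIn.mono (HaltsIn.set ⟨_, ?_, (hE.trans hE2).setVar, W, fun i => ?_, h2,
        ?_, rfl, ?_, ?_⟩) ?_ fun _ => id
      · simp [Expr.steps]; omega
      · simp [Expr.eval, hx2, hx]; omega
      · simpa using hC2 i
      · simp [Expr.eval, hx2]
      · intro y hy
        simp only [Expr.eval, setVar_var, if_true, hx2] at hy
        rcases Nat.lt_succ_iff_lt_or_eq.1 hy with hy | hy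
        · exact h5 y (by omega)
        · obtain rfl : y = x := Fin.ext hy
          rw [deserts_div_iff (hpq y)]
          rintro ⟨hxW, hlt⟩
          simp only [hxW, if_true] at hb
          omega
      · refine h6.imp (fun h => ⟨h.1, ?_, ?_⟩) ?_
        · simp [hE2.2 3 (by simp), h.2.1]
        · simp [hE2.1 1 (by simp), h.2.2]
        · rintro ⟨V, u, k1, k2, k3, k4, k5⟩
          refine ⟨V, u, k1, k2, k3, ?_, ?_⟩
          · simpa [hE2.2 3 (by simp)] using k4
          · simpa [hE2.1 1 (by simp)] using k5
  · exact ⟨(EqOff.refl ..).setVar, W₀, hC, hW₀, by simp [Expr.eval], by simp [Expr.eval],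
      by simp [Expr.eval], .inl ⟨rfl, rfl, rfl⟩⟩
  · rintro m' ⟨he, l, hE, W, h1, h2, h3, rfl, h5, h6⟩
    have hL1 := hL.congr hE
    have hn : m'.var 3 = n := by simp only [Expr.eval, hL1.size] at he; omega
    have hstable (y) : ¬ Deserts G α W y := h5 y (hn ▸ y.2)
    refine ⟨hE, h6.imp ?_ ?_⟩
    · rintro ⟨rfl, h⟩
      exact ⟨hstable, h⟩
    · rintro ⟨V, u, k1, k2, rfl, k4⟩
      exact ⟨_, u, isSwing_of_deserts (div_mem_Ioo hpq) (by simpa using k2) k1 hstable, k4⟩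
  · have := cut_le G W₀
    rw [Fintype.card_fin] at this
    have h1 : cut G W₀ * (n + 1) + n + 1 ≤ (n + 1) ^ 3 := by nlinarith
    simp only [Expr.steps]
    calc _ ≤ 2 + (n + 1) ^ 3 * ((n + 1) * 165) :=
        Nat.add_le_add_left (Nat.mul_le_mul h1 (by omega)) _
      _ = 2 + 165 * (n + 1) ^ 4 := by ring
      _ ≤ _ := by have := Nat.one_le_pow 4 (n + 1) (by omega); omega

/-- After the round of a non-stubborn vertex `v` the output cells hold a solution, since `v` deserts
the set from which that round starts. -/
lemma HaltsIn.swing (hn : Odd n) (hpq : ∀ i, 0 < p i ∧ p i < q i) (hL : Loaded G p q m)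
    (hv : ∃ v, ¬ IsStubborn G (fun i => (p i : ℝ) / (q i : ℝ)) v) :
    HaltsIn Program.swing m (500 * (n + 1) ^ 5) (Solved G p q) := by
  refine HaltsIn.mono (HaltsIn.forLoop (n := n) (t := (n + 1) * 200 + 200 * (n + 1) ^ 4)
    (fun k m' => EqOff [1, 2, 3, 4, 5, 6, 7, 8, 9, 10] [3, 4] m m' ∧
      ∀ v : Fin n, v < k → ¬ IsStubborn G (fun i => (p i : ℝ) / (q i : ℝ)) v → Solved G p q m')
    (fun k m' h => (hL.congr h.1).size) ?_ ?_) ?_ ?_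
  · exact ⟨(EqOff.refl ..).setVar, by simp⟩
  · rintro k m₁ ⟨hE, hS⟩ hk hkn
    have hL1 := hL.congr hE
    refine HaltsIn.bind (HaltsIn.camp (v := ⟨k, hkn⟩) hn hL1 hk) ?_
    rintro m₂ ⟨hE2, W, h1, h2, h3, h4⟩
    refine (HaltsIn.improve hpq (hL1.congr hE2) h1 h2).mono le_rfl ?_
    rintro m₃ ⟨hE3, h5⟩
    refine ⟨?_, ((hE.trans hE2).trans hE3).setVar, fun v hvk hv => ?_⟩
    · rw [hE3.1 _ (by simp), hE2.1 _ (by simp), hk]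
    suffices Solved G p q m₃ by
      obtain ⟨b, u, hb, ho⟩ := this
      exact ⟨b, u, hb, ho.1, by simpa using ho.2⟩
    rcases h5 with ⟨h5, h6, h7⟩ | h5
    · rcases Nat.lt_succ_iff_lt_or_eq.1 hvk with hvk | hvk
      · obtain ⟨b, u, hb, ho⟩ := hS v hvk hv
        refine ⟨b, u, hb, ?_, ?_⟩
        · rw [h6, hE2.2 _ (by simp)]; exact ho.1
        · rw [h7, hE2.1 _ (by simp)]; exact ho.2
      · obtain rfl : v = ⟨k, hkn⟩ := Fin.ext hvk
        exact (h5 _ (deserts_of_not_isStubborn (div_mem_Ioo hpq _) hv (by simpa using h2)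
          h3 h4)).elim
    · exact h5
  · have h1 : (n + 1) ≤ (n + 1) ^ 4 := Nat.le_self_pow (by simp) _
    calc _ ≤ (n + 1) * (500 * (n + 1) ^ 4) := Nat.mul_le_mul_left _ (by omega)
      _ = _ := by ring
  · rintro m' ⟨-, hS⟩
    obtain ⟨v, hv⟩ := hv
    exact hS v v.2 hv

end Correctness

end PrefGame

theorem mainTheorem1 :
    (∀ (V : Type*) [Fintype V] (G : SimpleGraph V) (α : V → ℝ),
      Odd (Fintype.card V) → (∀ x, α x ∈ Set.Ioo (0 : ℝ) 1) →
      (∃ x, ¬ PrefGame.IsStubborn G α x) →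
      ∃ (b : V → Bool) (u : V),
        PrefGame.IsSubvertable G α b ∧ PrefGame.IsSwing G α b u) ∧
    (∃ (P : PrefGame.Program) (T : Polynomial ℕ),
      ∀ (n : ℕ) (G : SimpleGraph (Fin n)) (p q : Fin n → ℕ),
        Odd n → (∀ i, 0 < p i ∧ p i < q i) →
        (∃ x, ¬ PrefGame.IsStubborn G (fun i => (p i : ℝ) / (q i : ℝ)) x) →
        ∃ (b : Fin n → Bool) (u : Fin n) (m : PrefGame.Memory) (t : ℕ),
          PrefGame.IsSubvertable G (fun i => (p i : ℝ) / (q i : ℝ)) b ∧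
          PrefGame.IsSwing G (fun i => (p i : ℝ) / (q i : ℝ)) b u ∧
          PrefGame.Runs P (PrefGame.input G p q) m t ∧ t ≤ T.eval n ∧
          PrefGame.IsOutput m b u) := by
  refine ⟨fun V _ G α hV hα ⟨v, hv⟩ => ?_, PrefGame.Program.swing,
    500 * (Polynomial.X + 1) ^ 5, fun n G p q hn hpq hv => ?_⟩
  · classical
    obtain ⟨W, hW, hd⟩ := PrefGame.exists_deserts hV (hα v) hv
    obtain ⟨b, u, h⟩ := PrefGame.exists_isSwing hα hW hd
    exact ⟨b, u, h.subvertable, h⟩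
  · obtain ⟨m, t, hr, ht, b, u, hb, ho⟩ :=
      PrefGame.HaltsIn.swing hn hpq PrefGame.loaded_input hv
    exact ⟨b, u, m, t, hb.subvertable, hb, hr, by simpa using ht, ho⟩
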